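/- Let $W$ be any Coxeter group (with a fixed set of simple reflections), with length function $w\mapsto |w|$ and Bruhat order $\le$. Let $H$ be its generic Iwahori–Hecke algebra over $\mathbf Z[q^{1/2},q^{-1/2}]$, with standard basis $(T_w)_{w\in W}$ and relations $T_sT_w=T_{sw}$ if $|sw|>|w|$, $(T_s+1)(T_s-q)=0$ ($s$ a simple reflection). Let a bar denote the ring involution $q^{1/2}\mapsto q^{-1/2}$ of $\mathbf Z[q^{1/2},q^{-1/2}]$, and also the involution $\overline{\sum a_wT_w}=\sum\overline{a_w}\,T_{w^{-1}}^{-1}$ of $H$. Let $R_{y,x},P_{y,x},Q_{y,x}\in\mathbf Z[q]$ ($y\le x$) be the following polynomials of Kazhdan and Lusztig: * $R_{y,x}$ is defined by $T_{x^{-1}}^{-1}=\sum_{y\le x}\overline{R_{y,x}}\,q^{-|y|}T_y$; * $(P_{y,x})_{y\le x}$ is, for each $x$, the unique family of polynomials in $q$ with $P_{x,x}=1$ and $\deg P_{y,x}\le\frac12(|x|-|y|-1)$ for $y<x$ for which the element $C_x=\sum_{y\le x}(-1)^{|y|+|x|}q^{|x|/2}q^{-|y|}\,\overline{P_{y,x}}\,T_y$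 satisfies $\overline{C_x}=C_x$; * $Q_{y,x}$ is defined by $\sum_{y\le z\le x}(-1)^{|y|+|z|}P_{y,z}Q_{z,x}=\delta_{y,x}$. For $y\le x$ in $W$ set $$\Xi_{y,x}=\sum_{y\le y'\le x'\le x}Q_{y,y'}\,R_{y',x'}\,P_{x',x}\in\mathbf Z[q].$$ Then, in $\mathbf Z[q,q^{-1}]$, for all $y\le x$ in $W$: $$\Xi_{y,x}=q^{|x|}\sum_{y\le y'\le x}q^{-|y'|}\,Q_{y,y'}\,\overline{P_{y',x}},\tag{b}$$ $$\Xi_{y,x}=q^{-|y|}\sum_{y\le x'\le x}q^{|x'|}\,\overline{Q_{y,x'}}\,P_{x',x},\tag{c}$$ $$\overline{\Xi_{y,x}}=q^{|y|-|x|}\,\Xi_{y,x}.\tag{d}$$ -/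

import Mathlib

namespace KazhdanLusztig

variable {B W : Type*} [Group W] {M : CoxeterMatrix B} (cs : CoxeterSystem M W)

open Classical in
/-- The generators of `reflAction`. -/
noncomputable def reflStep (i : B) : Function.End (W × ZMod 2) :=
  fun p => (cs.simple i * p.1 * cs.simple i, p.2 + if p.1 = cs.simple i then 1 else 0)

open Classical in
theorem reflStep_prod (ω : List B) (u : W) (e : ZMod 2) :
    ((ω.map (reflStep cs)).prod : Function.End (W × ZMod 2)) (u, e) =
      (cs.wordProd ω * u * (cs.wordProd ω)⁻¹, e + ((cs.rightInvSeq ω).count u : ℕ)) := by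
  induction ω with
  | nil => simp [Function.End.one_def]
  | cons i ω ih =>
    rw [List.map_cons, List.prod_cons]
    change reflStep cs i ((List.map (reflStep cs) ω).prod (u, e)) = _
    rw [ih]
    have h : (cs.wordProd ω * u * (cs.wordProd ω)⁻¹ = cs.simple i) ↔
        ((cs.wordProd ω)⁻¹ * cs.simple i * cs.wordProd ω = u) := by
      constructor
      · intro h; rw [← h]; group
      · intro h; rw [← h]; group
    simp only [reflStep, cs.wordProd_cons, CoxeterSystem.rightInvSeq, List.count_cons, beq_iff_eq]
    refine Prod.ext ?_ ?_
    · simp [mul_assoc]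
    · simp only [h]
      split_ifs <;> simp [add_assoc]

theorem pow_eq_prod_alternating {G : Type*} [Monoid G] (f : B → G) (i j : B) (m : ℕ) :
    (f i * f j) ^ m = ((CoxeterSystem.alternatingWord i j (2 * m)).map f).prod := by
  induction m with
  | zero => simp [CoxeterSystem.alternatingWord]
  | succ m ih =>
    rw [pow_succ, ih, show 2 * (m + 1) = 2 * m + 1 + 1 by ring,
      CoxeterSystem.alternatingWord_succ, CoxeterSystem.alternatingWord_succ]
    simp

open Classical in
theorem even_count_rightInvSeq (i j : B) (u : W) :
    Even ((cs.rightInvSeq (CoxeterSystem.alternatingWord i j (2 * M i j))).count u) := by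
  have hrev : CoxeterSystem.alternatingWord i j (2 * M i j) =
      (CoxeterSystem.alternatingWord j i (2 * M i j)).reverse := by
    generalize M i j = m
    induction m with
    | zero => simp [CoxeterSystem.alternatingWord]
    | succ m ih =>
      rw [show 2 * (m + 1) = 2 * m + 1 + 1 by ring, CoxeterSystem.alternatingWord_succ' j i,
        CoxeterSystem.alternatingWord_succ' j i, CoxeterSystem.alternatingWord_succ i j,
        CoxeterSystem.alternatingWord_succ j i, ih]
      simp
  rw [hrev, cs.rightInvSeq_reverse, List.count_reverse]
  set l := cs.leftInvSeq (CoxeterSystem.alternatingWord j i (2 * M i j)) with hl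
  have hlen : l.length = 2 * M i j := by simp [hl]
  have key : l.take (M i j) = l.drop (M i j) := by
    apply List.ext_getElem
    · simp [hlen]; omega
    · intro k h1 h2
      simp only [List.length_take, hlen] at h1
      rw [List.getElem_take, List.getElem_drop]
      simp only [hl]
      rw [cs.getElem_leftInvSeq_alternatingWord j i _ _ (by omega),
        cs.getElem_leftInvSeq_alternatingWord j i _ _ (by omega),
        cs.prod_alternatingWord_eq_mul_pow, cs.prod_alternatingWord_eq_mul_pow]
      have e1 : ¬ Even (2 * k + 1) := by simp
      have e2 : ¬ Even (2 * (M i j + k) + 1) := by simp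
      rw [if_neg e1, if_neg e2, show (2 * k + 1) / 2 = k by omega,
        show (2 * (M i j + k) + 1) / 2 = M i j + k by omega, pow_add]
      simp
  rw [← List.take_append_drop (M i j) l, key, List.count_append]
  exact ⟨_, rfl⟩

theorem reflStep_isLiftable : M.IsLiftable (reflStep cs) := by
  intro i j
  rw [pow_eq_prod_alternating]
  funext ⟨u, e⟩
  rw [reflStep_prod]
  have h1 : cs.wordProd (CoxeterSystem.alternatingWord i j (2 * M i j)) = 1 := by
    rw [CoxeterSystem.wordProd, ← pow_eq_prod_alternating]
    exact cs.simple_mul_simple_pow i j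
  obtain ⟨r, hr⟩ := even_count_rightInvSeq cs i j u
  rw [h1, hr]
  simp [Function.End.one_def, CharTwo.add_self_eq_zero]

/-- The action of `W` on pairs (element, parity) by conjugation, recording inversions. -/
noncomputable def reflAction : W →* Function.End (W × ZMod 2) :=
  cs.lift ⟨reflStep cs, reflStep_isLiftable cs⟩

/-- The parity of the number of times that `u` occurs in the right inversion sequence of a word for
`w`. -/
noncomputable def inversionParity (w u : W) : ZMod 2 := (reflAction cs w (u, 0)).2

theorem reflAction_wordProd (ω : List B) :
    reflAction cs (cs.wordProd ω) = (ω.map (reflStep cs)).prod := by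
  rw [CoxeterSystem.wordProd, map_list_prod, List.map_map]
  congr 2
  funext i
  exact cs.lift_apply_simple _ i

open Classical in
theorem inversionParity_wordProd (ω : List B) (u : W) :
    inversionParity cs (cs.wordProd ω) u = ((cs.rightInvSeq ω).count u : ℕ) := by
  rw [inversionParity, reflAction_wordProd, reflStep_prod]
  simp

theorem reflAction_apply (w u : W) (e : ZMod 2) :
    reflAction cs w (u, e) = (w * u * w⁻¹, e + inversionParity cs w u) := by
  classical
  obtain ⟨ω, rfl⟩ := cs.wordProd_surjective w
  rw [inversionParity_wordProd, reflAction_wordProd, reflStep_prod]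

theorem inversionParity_mul (w w' u : W) :
    inversionParity cs (w * w') u =
      inversionParity cs w' u + inversionParity cs w (w' * u * w'⁻¹) := by
  rw [inversionParity, map_mul]
  change (reflAction cs w (reflAction cs w' (u, 0))).2 = _
  rw [reflAction_apply, reflAction_apply]
  simp

theorem inversionParity_one (u : W) : inversionParity cs 1 u = 0 := by
  rw [inversionParity, map_one]; rfl

theorem inversionParity_self {t : W} (ht : cs.IsReflection t) : inversionParity cs t t = 1 := by
  classical
  obtain ⟨w, i, rfl⟩ := ht
  have hs : inversionParity cs (cs.simple i) (cs.simple i) = 1 := by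
    have := inversionParity_wordProd cs [i] (cs.simple i)
    simpa using this
  have h0 := inversionParity_mul cs w w⁻¹ (w * cs.simple i * w⁻¹)
  rw [mul_inv_cancel, inversionParity_one] at h0
  rw [inversionParity_mul, inversionParity_mul]
  have e : w⁻¹ * (w * cs.simple i * w⁻¹) * w⁻¹⁻¹ = cs.simple i := by group
  rw [e] at h0 ⊢
  rw [mul_inv_cancel_right, hs, add_left_comm, ← h0, add_zero]

theorem mem_rightInvSeq_of_length_lt {ω : List B} {t : W} (ht : cs.IsReflection t)
    (hlt : cs.length (cs.wordProd ω * t) < cs.length (cs.wordProd ω)) :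
    t ∈ cs.rightInvSeq ω := by
  classical
  by_contra hmem
  have h0 : inversionParity cs (cs.wordProd ω) t = 0 := by
    rw [inversionParity_wordProd, List.count_eq_zero_of_not_mem hmem]; simp
  obtain ⟨ω', hω', hw⟩ := cs.exists_isReduced (cs.wordProd ω * t)
  have h1 : inversionParity cs (cs.wordProd ω * t) t = 1 := by
    rw [inversionParity_mul, inversionParity_self cs ht]
    simp [h0]
  have hmem' : t ∈ cs.rightInvSeq ω' := by
    rw [hw, inversionParity_wordProd] at h1
    by_contra hn
    rw [List.count_eq_zero_of_not_mem hn] at h1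
    simp at h1
  have h2 := (cs.isRightInversion_of_mem_rightInvSeq hω' hmem').2
  rw [← hw, mul_assoc, ht.mul_self, mul_one] at h2
  omega

/-- The exchange condition. -/
theorem exists_eraseIdx_of_length_lt {ω : List B} {t : W} (ht : cs.IsReflection t)
    (hlt : cs.length (cs.wordProd ω * t) < cs.length (cs.wordProd ω)) :
    ∃ j < ω.length, cs.wordProd ω * t = cs.wordProd (ω.eraseIdx j) := by
  obtain ⟨j, hj, rfl⟩ := List.mem_iff_getElem.mp (mem_rightInvSeq_of_length_lt cs ht hlt)
  refine ⟨j, by simpa using hj, ?_⟩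
  rw [← cs.wordProd_mul_getD_rightInvSeq, List.getD_eq_getElem _ 1 hj]

theorem simple_mul_eq_mul_simple_of_lt {w : W} {i j : B}
    (h1 : cs.length w < cs.length (cs.simple i * w))
    (h2 : cs.length (cs.simple i * w * cs.simple j) = cs.length w)
    (h3 : cs.length (cs.simple i * w) = cs.length (w * cs.simple j)) :
    cs.simple i * w = w * cs.simple j := by
  obtain ⟨ω, hω, rfl⟩ := cs.exists_isReduced w
  rw [← cs.wordProd_cons] at h1 h2 h3 ⊢
  obtain ⟨k, hk, he⟩ := exists_eraseIdx_of_length_lt cs (ω := i :: ω) (cs.isReflection_simple j)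
    (by omega)
  cases k with
  | zero =>
    rw [List.eraseIdx_cons_zero] at he
    rw [← he, cs.simple_mul_simple_cancel_right]
  | succ k =>
    exfalso
    rw [List.eraseIdx_cons_succ, cs.wordProd_cons, cs.wordProd_cons, mul_assoc] at he
    rw [mul_left_cancel he] at h3
    have := cs.length_wordProd_le (ω.eraseIdx k)
    have h4 : (ω.eraseIdx k).length ≤ ω.length := List.length_eraseIdx_le ω k
    have := hω.eq
    omega

theorem simple_mul_eq_mul_simple {w : W} {i j : B}
    (h2 : cs.length (cs.simple i * w * cs.simple j) = cs.length w)
    (h3 : cs.length (cs.simple i * w) = cs.length (w * cs.simple j)) :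
    cs.simple i * w = w * cs.simple j := by
  rcases lt_or_gt_of_ne (cs.length_simple_mul_ne w i) with h | h
  · have := simple_mul_eq_mul_simple_of_lt cs (w := cs.simple i * w) (i := i) (j := j)
      (by simpa using h) (by simpa using h3.symm) (by simpa using h2.symm)
    rw [cs.simple_mul_simple_cancel_left] at this
    nth_rw 2 [this]
    rw [cs.simple_mul_simple_cancel_right]
  · exact simple_mul_eq_mul_simple_of_lt cs h h2 h3


/-- The standard partial order (Bruhat order): `y ≤ x` if there is a chain from `y` to `x` whose steps
are right multiplications by reflections that increase the length. -/
def BruhatLE (y x : W) : Prop :=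
  Relation.ReflTransGen
    (fun u v => ∃ t, cs.IsReflection t ∧ v = u * t ∧ cs.length u < cs.length v) y x

theorem BruhatLE.eq_or_length_lt {y x : W} (h : BruhatLE cs y x) :
    y = x ∨ cs.length y < cs.length x := by
  induction h with
  | refl => exact Or.inl rfl
  | tail _ h ih =>
    obtain ⟨t, -, -, hlt⟩ := h
    rcases ih with rfl | ih
    · exact Or.inr hlt
    · exact Or.inr (ih.trans hlt)

theorem finite_bruhatLE (x : W) : {y | BruhatLE cs y x}.Finite := by
  induction hn : cs.length x using Nat.strong_induction_on generalizing x with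
  | _ n ih =>
    obtain ⟨ω, hω, rfl⟩ := cs.exists_isReduced x
    have hfin : {u : W | ∃ j < ω.length, u = cs.wordProd (ω.eraseIdx j)}.Finite := by
      refine ((Finset.range ω.length).finite_toSet.image
        (fun j => cs.wordProd (ω.eraseIdx j))).subset ?_
      rintro u ⟨j, hj, rfl⟩
      exact ⟨j, by simpa using hj, rfl⟩
    have hlow : {u : W | (∃ j < ω.length, u = cs.wordProd (ω.eraseIdx j)) ∧
        cs.length u < n}.Finite := hfin.subset (fun u hu => hu.1)
    refine ((Set.finite_singleton (cs.wordProd ω)).union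
      (hlow.biUnion (fun u hu => ih _ hu.2 u rfl))).subset ?_
    intro y hy
    rcases Relation.ReflTransGen.cases_tail hy with h | ⟨u, hyu, t, ht, hv, hlt⟩
    · exact Or.inl h.symm
    · refine Or.inr (Set.mem_biUnion (x := u) ?_ hyu)
      have hu : u = cs.wordProd ω * t := by rw [hv, mul_assoc, ht.mul_self, mul_one]
      refine ⟨?_, hn ▸ hlt⟩
      rw [hu]
      exact exists_eraseIdx_of_length_lt cs ht (hu ▸ hlt)

open Classical in
/-- The Bruhat interval `{z | y ≤ z ≤ x}`. -/
noncomputable def bruhatIcc (y x : W) : Finset W :=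
  (finite_bruhatLE cs x).toFinset.filter fun z => BruhatLE cs y z

theorem mem_bruhatIcc {y x z : W} :
    z ∈ bruhatIcc cs y x ↔ BruhatLE cs y z ∧ BruhatLE cs z x := by
  simp [bruhatIcc, and_comm]

open LaurentPolynomial Polynomial

/-- The underlying `ℤ[q^{1/2}, q^{-1/2}]`-module of the generic Iwahori-Hecke algebra: it is free
with basis indexed by `W`. The Laurent variable `T 1` stands for `q^{1/2}`, hence `T 2` is `q`. -/
def Hecke (_cs : CoxeterSystem M W) : Type _ := W →₀ ℤ[T;T⁻¹]

namespace Hecke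

noncomputable instance : AddCommGroup (Hecke cs) := inferInstanceAs (AddCommGroup (W →₀ ℤ[T;T⁻¹]))

noncomputable instance : Module ℤ[T;T⁻¹] (Hecke cs) :=
  inferInstanceAs (Module ℤ[T;T⁻¹] (W →₀ ℤ[T;T⁻¹]))

/-- The standard basis `(T_w)`. -/
noncomputable def basis : Module.Basis W ℤ[T;T⁻¹] (Hecke cs) := Finsupp.basisSingleOne

/-- Left multiplication by `T_s`: `T_w ↦ T_{sw}` if `sw > w`, and
`T_w ↦ (q - 1) T_w + q T_{sw}` otherwise. -/
noncomputable def leftOp (i : B) : Module.End ℤ[T;T⁻¹] (Hecke cs) :=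
  (basis cs).constr ℤ fun w =>
    if cs.length w < cs.length (cs.simple i * w) then basis cs (cs.simple i * w)
    else (T 2 - 1 : ℤ[T;T⁻¹]) • basis cs w + (T 2 : ℤ[T;T⁻¹]) • basis cs (cs.simple i * w)

/-- Right multiplication by `T_s`. -/
noncomputable def rightOp (i : B) : Module.End ℤ[T;T⁻¹] (Hecke cs) :=
  (basis cs).constr ℤ fun w =>
    if cs.length w < cs.length (w * cs.simple i) then basis cs (w * cs.simple i)
    else (T 2 - 1 : ℤ[T;T⁻¹]) • basis cs w + (T 2 : ℤ[T;T⁻¹]) • basis cs (w * cs.simple i)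

theorem leftOp_basis (i : B) (w : W) : leftOp cs i (basis cs w) =
    if cs.length w < cs.length (cs.simple i * w) then basis cs (cs.simple i * w)
    else (T 2 - 1 : ℤ[T;T⁻¹]) • basis cs w +
      (T 2 : ℤ[T;T⁻¹]) • basis cs (cs.simple i * w) :=
  (basis cs).constr_basis ℤ _ w

theorem rightOp_basis (i : B) (w : W) : rightOp cs i (basis cs w) =
    if cs.length w < cs.length (w * cs.simple i) then basis cs (w * cs.simple i)
    else (T 2 - 1 : ℤ[T;T⁻¹]) • basis cs w +
      (T 2 : ℤ[T;T⁻¹]) • basis cs (w * cs.simple i) :=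
  (basis cs).constr_basis ℤ _ w

theorem leftOp_rightOp_comm (i j : B) : Commute (leftOp cs i) (rightOp cs j) := by
  refine (basis cs).ext fun w => ?_
  rw [Module.End.mul_apply, Module.End.mul_apply, leftOp_basis, rightOp_basis]
  have hl := cs.length_simple_mul w i
  have hr := cs.length_mul_simple w j
  have hlr := cs.length_mul_simple (cs.simple i * w) j
  have hrl := cs.length_simple_mul (w * cs.simple j) i
  rw [← mul_assoc] at hrl
  have key := @simple_mul_eq_mul_simple B W _ M cs w i j
  by_cases h1 : cs.length w < cs.length (cs.simple i * w) <;>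
  by_cases h2 : cs.length w < cs.length (w * cs.simple j) <;>
  by_cases h3 : cs.length (cs.simple i * w) < cs.length (cs.simple i * w * cs.simple j) <;>
  by_cases h4 : cs.length (w * cs.simple j) < cs.length (cs.simple i * w * cs.simple j) <;>
  first
  | (exfalso; omega)
  | (have e := key (by omega) (by omega)
     simp only [h1, h2, h3, h4, if_true, if_false, map_add, map_smul, leftOp_basis, rightOp_basis,
      ← mul_assoc]
     rw [e])
  | (simp only [h1, h2, h3, h4, if_true, if_false, map_add, map_smul, leftOp_basis, rightOp_basis,
      ← mul_assoc]
     done)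
  | (simp only [h1, h2, h3, h4, if_false, map_add, map_smul, leftOp_basis, rightOp_basis,
      ← mul_assoc]
     module)

/-- A reduced word of `w`. -/
noncomputable def reducedWord (w : W) : List B := (cs.exists_isReduced w).choose

theorem reducedWord_isReduced (w : W) : cs.IsReduced (reducedWord cs w) :=
  (cs.exists_isReduced w).choose_spec.1

theorem wordProd_reducedWord (w : W) : cs.wordProd (reducedWord cs w) = w :=
  (cs.exists_isReduced w).choose_spec.2.symm

/-- Left multiplication by `a`, linear in `a`: `T_w` for `w = s₁⋯sₖ` reduced acts as
`T_{s₁}⋯T_{sₖ}`. -/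
noncomputable def leftMul : Hecke cs →ₗ[ℤ[T;T⁻¹]] Module.End ℤ[T;T⁻¹] (Hecke cs) :=
  (basis cs).constr ℤ fun w => ((reducedWord cs w).map (leftOp cs)).prod

theorem leftMul_basis (w : W) :
    leftMul cs (basis cs w) = ((reducedWord cs w).map (leftOp cs)).prod :=
  (basis cs).constr_basis ℤ _ w

theorem prod_leftOp_one {ω : List B} (hω : cs.IsReduced ω) :
    (ω.map (leftOp cs)).prod (basis cs 1) = basis cs (cs.wordProd ω) := by
  induction ω with
  | nil => simp
  | cons i ω ih =>
    have h' : cs.IsReduced ω := by simpa using hω.drop 1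
    rw [List.map_cons, List.prod_cons, Module.End.mul_apply, ih h', leftOp_basis, cs.wordProd_cons,
      if_pos]
    have h1 := hω.eq
    rw [cs.wordProd_cons, List.length_cons] at h1
    have h2 := h'.eq
    omega

theorem leftMul_one (a : Hecke cs) : leftMul cs a (basis cs 1) = a := by
  have : (leftMul cs).flip (basis cs 1) = LinearMap.id := by
    refine (basis cs).ext fun w => ?_
    rw [LinearMap.flip_apply, leftMul_basis, prod_leftOp_one cs (reducedWord_isReduced cs w),
      wordProd_reducedWord, LinearMap.id_apply]
  exact LinearMap.congr_fun this a

theorem leftMul_commute (a : Hecke cs) (j : B) : Commute (leftMul cs a) (rightOp cs j) := by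
  have h : LinearMap.mulRight ℤ[T;T⁻¹] (rightOp cs j) ∘ₗ leftMul cs =
      LinearMap.mulLeft ℤ[T;T⁻¹] (rightOp cs j) ∘ₗ leftMul cs := by
    refine (basis cs).ext fun w => ?_
    rw [LinearMap.comp_apply, LinearMap.comp_apply, LinearMap.mulRight_apply,
      LinearMap.mulLeft_apply, leftMul_basis]
    refine Commute.list_prod_left _ _ ?_
    simp only [List.mem_map]
    rintro _ ⟨i, -, rfl⟩
    exact leftOp_rightOp_comm cs i j
  exact LinearMap.congr_fun h a

theorem prod_rightOp_one {ω : List B} (hω : cs.IsReduced ω) :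
    (ω.reverse.map (rightOp cs)).prod (basis cs 1) = basis cs (cs.wordProd ω) := by
  induction ω using List.reverseRecOn with
  | nil => simp
  | append_singleton ω i ih =>
    have h' : cs.IsReduced ω := by simpa using hω.take ω.length
    rw [List.reverse_append, List.reverse_singleton, List.singleton_append, List.map_cons,
      List.prod_cons, Module.End.mul_apply, ih h', rightOp_basis, cs.wordProd_append,
      cs.wordProd_singleton, if_pos]
    have h1 := hω.eq
    rw [cs.wordProd_append, cs.wordProd_singleton, List.length_append, List.length_singleton] at h1
    have h2 := h'.eq
    omega

theorem ext_of_commute {F G : Module.End ℤ[T;T⁻¹] (Hecke cs)}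
    (hF : ∀ j, Commute F (rightOp cs j)) (hG : ∀ j, Commute G (rightOp cs j))
    (h : F (basis cs 1) = G (basis cs 1)) : F = G := by
  refine (basis cs).ext fun w => ?_
  obtain ⟨ω, hω, rfl⟩ := cs.exists_isReduced w
  rw [← prod_rightOp_one cs hω]
  have c : ∀ {E : Module.End ℤ[T;T⁻¹] (Hecke cs)}, (∀ j, Commute E (rightOp cs j)) →
      Commute E (ω.reverse.map (rightOp cs)).prod := by
    intro E hE
    apply Commute.list_prod_right
    simp only [List.mem_map]
    rintro _ ⟨j, -, rfl⟩
    exact hE j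
  rw [← Module.End.mul_apply, ← Module.End.mul_apply, c hF, c hG, Module.End.mul_apply,
    Module.End.mul_apply, h]

noncomputable instance : One (Hecke cs) := ⟨basis cs 1⟩

noncomputable instance : Mul (Hecke cs) := ⟨fun a b => leftMul cs a b⟩

theorem one_def : (1 : Hecke cs) = basis cs 1 := rfl

theorem mul_def (a b : Hecke cs) : a * b = leftMul cs a b := rfl

theorem leftMul_mul (a b : Hecke cs) : leftMul cs (a * b) = leftMul cs a * leftMul cs b := by
  refine ext_of_commute cs (leftMul_commute cs _)
    (fun j => (leftMul_commute cs a j).mul_left (leftMul_commute cs b j)) ?_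
  rw [leftMul_one, Module.End.mul_apply, leftMul_one, mul_def]

theorem leftMul_basis_one : leftMul cs (basis cs 1) = 1 :=
  ext_of_commute cs (leftMul_commute cs _) (fun _ => Commute.one_left _) (leftMul_one cs _)

noncomputable instance : Ring (Hecke cs) :=
  { (inferInstance : AddCommGroup (Hecke cs)) with
    one := 1
    mul := (· * ·)
    mul_assoc := fun a b c => by
      rw [mul_def cs (a * b), leftMul_mul]; rfl
    one_mul := fun a => by rw [mul_def, one_def, leftMul_basis_one]; rfl
    mul_one := fun a => leftMul_one cs a
    left_distrib := fun a b c => map_add (leftMul cs a) b c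
    right_distrib := fun a b c => by simp only [mul_def, map_add, LinearMap.add_apply]
    zero_mul := fun a => by simp only [mul_def, map_zero, LinearMap.zero_apply]
    mul_zero := fun a => map_zero (leftMul cs a) }

noncomputable instance : Algebra ℤ[T;T⁻¹] (Hecke cs) :=
  Algebra.ofModule
    (fun r a b => by simp only [mul_def, map_smul, LinearMap.smul_apply])
    (fun r a b => map_smul (leftMul cs a) r b)

/-- The multiplication of `Hecke cs` is the one of the generic Iwahori-Hecke algebra:
`T_s T_w = T_{sw}` if `sw > w`, and `T_s T_w = (q - 1) T_w + q T_{sw}` otherwise. -/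
theorem basis_simple_mul_basis (i : B) (w : W) :
    basis cs (cs.simple i) * basis cs w =
      if cs.length w < cs.length (cs.simple i * w) then basis cs (cs.simple i * w)
      else (T 2 - 1 : ℤ[T;T⁻¹]) • basis cs w +
        (T 2 : ℤ[T;T⁻¹]) • basis cs (cs.simple i * w) := by
  have h : leftMul cs (basis cs (cs.simple i)) = leftOp cs i :=
    ext_of_commute cs (leftMul_commute cs _) (leftOp_rightOp_comm cs i)
      (by rw [leftMul_one, leftOp_basis]; simp)
  rw [mul_def, h, leftOp_basis]

/-- The bar involution
`∑ a_w T_w ↦ ∑ ā_w (T_{w⁻¹})⁻¹`, where `ā` is `a` with `q^{1/2}` and `q^{-1/2}` exchanged. -/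
noncomputable def bar (h : Hecke cs) : Hecke cs :=
  ((basis cs).repr h).sum fun w a => LaurentPolynomial.invert a • Ring.inverse (basis cs w⁻¹)

end Hecke

/-- The polynomial `R_{y,x}`: the unique `r ∈ ℤ[q]` for which the coefficient of `T_y` in
`(T_{x⁻¹})⁻¹` is `q^{-|y|}` times the bar conjugate of `r`. -/
noncomputable def klR (y x : W) : ℤ[X] :=
  Classical.epsilon fun r : ℤ[X] =>
    (Hecke.basis cs).repr (Ring.inverse (Hecke.basis cs x⁻¹)) y =
      LaurentPolynomial.invert (aeval (T 2 : ℤ[T;T⁻¹]) r) * T (-2 * (cs.length y : ℤ))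

/-- The element
`∑_{y ≤ x} (-1)^{|y| + |x|} q^{|x|/2} q^{-|y|} p̄_y T_y` of the Hecke algebra, for a family
`p` of polynomials in `q`. -/
noncomputable def klElement (x : W) (p : W → ℤ[X]) : Hecke cs :=
  ∑ y ∈ (finite_bruhatLE cs x).toFinset,
    ((-1) ^ (cs.length y + cs.length x) * T (cs.length x : ℤ) * T (-2 * (cs.length y : ℤ)) *
      LaurentPolynomial.invert (aeval (T 2 : ℤ[T;T⁻¹]) (p y))) • Hecke.basis cs y

/-- `p y = P_{y,x}` for all `y ≤ x`, extended by `0`: the polynomials satisfy `P_{x,x} = 1` and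
`deg P_{y,x} ≤ (|x| - |y| - 1) / 2` for `y < x`, and the element `C_x` that they define is
fixed by the bar involution. -/
structure IsKLFamily (x : W) (p : W → ℤ[X]) : Prop where
  eq_zero : ∀ y, ¬ BruhatLE cs y x → p y = 0
  eq_one : p x = 1
  degree_le : ∀ y, BruhatLE cs y x → y ≠ x →
    2 * (p y).natDegree + cs.length y + 1 ≤ cs.length x
  bar_eq : Hecke.bar cs (klElement cs x p) = klElement cs x p

/-- The Kazhdan-Lusztig polynomial `P_{y,x}`, where `(P_{y,x})_y` is the unique family that
satisfies `IsKLFamily`. -/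
noncomputable def klP (y x : W) : ℤ[X] := Classical.epsilon (IsKLFamily cs x) y

open Classical in
/-- The inverse Kazhdan-Lusztig polynomial `Q_{y,x}`: `Q_{x,x} = 1`, and
`∑_{y ≤ z ≤ x} (-1)^{|y| + |z|} P_{y,z} Q_{z,x} = 0` for `y < x`, which is solved here
for the term `z = y`. -/
noncomputable def klQ (y x : W) : ℤ[X] :=
  if y = x then 1
  else - ∑ z : {z // z ∈ (bruhatIcc cs y x).erase y},
    (-1) ^ (cs.length y + cs.length z.1) * klP cs y z.1 * klQ z.1 x
termination_by cs.length x - cs.length y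
decreasing_by
  have hz := z.2
  rw [Finset.mem_erase, mem_bruhatIcc] at hz
  obtain ⟨hne, h1, h2⟩ := hz
  have h3 := (h1.eq_or_length_lt cs).resolve_left (Ne.symm hne)
  rcases h2.eq_or_length_lt cs with h4 | h4
  · rw [h4] at h3 ⊢; omega
  · omega

/-- `Ξ_{y,x} = ∑ Q_{y,y'} R_{y',x'} P_{x',x}`, summed over `y ≤ y' ≤ x' ≤ x`. -/
noncomputable def klXi (y x : W) : ℤ[X] :=
  ∑ x' ∈ bruhatIcc cs y x, ∑ y' ∈ bruhatIcc cs y x',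
    klQ cs y y' * klR cs y' x' * klP cs x' x

end KazhdanLusztig

/-!
The three identities follow from three facts about incidence matrices on Bruhat intervals. Write
`ε_{y,x} = (-1)^{|y| + |x|}`.

* `sum_klR_mul_klR`: `∑ ε_{y,z} R_{y,z} R_{z,x} = δ_{y,x}`. This says that bar is an involution of the
  Hecke algebra (`Hecke.bar_bar_basis`), together with `invert_klR`, the symmetry
  `R̄_{y,x} = ε_{y,x} q^{|y| - |x|} R_{y,x}`.
* `sum_klR_mul_klP`: `∑ R_{y,z} P_{z,x} = q^{|x| - |y|} P̄_{y,x}`. This is the bar invariance of `C_x`,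
  read off on coefficients (`bar_klElement_eq_iff`).
* `sum_klP_mul_klQ`: up to signs, the matrices `P` and `Q` are inverse to each other.

Inverting the second equation by means of the other two gives
`∑ Q_{y,z} R_{z,x} = q^{|x| - |y|} Q̄_{y,x}` (`sum_klQ_mul_klR`). Now `Ξ = Q R P`: evaluating `R P`
first expresses it by `Q` and `P̄`, evaluating `Q R` first expresses it by `Q̄` and `P`, and these two
expressions are bar conjugates of each other up to a power of `q`.

Everything about `R` comes from the recursion `klR_simple_mul_of_gt`, `klR_simple_mul_of_lt`, which
is multiplication by `T_s⁻¹`; that `R_{y,x}` vanishes unless `y ≤ x` also uses the lifting property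
`BruhatLE.simple_mul`. The polynomials `P` are defined by a choice, so that their existence has to be
proved (`isKLFamily_klSolution`). By descending recursion on `y`, the equation for `P_{y,x}` is
`q^{|x| - |y|} P̄_{y,x} - P_{y,x} = G` with `G = ∑_{z > y} R_{y,z} P_{z,x}` already known. The facts on
`R` show that `q^{|x| - |y|} Ḡ = -G`, so that minus the lower half of `G` is a solution of the required
degree.
-/

namespace KazhdanLusztig

open LaurentPolynomial Polynomial

variable {B W : Type*} [Group W] {M : CoxeterMatrix B} (cs : CoxeterSystem M W)

/-! ### The lifting property of the Bruhat order -/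

variable {cs} in
theorem BruhatLE.trans {x y z : W} (h : BruhatLE cs x y) (h' : BruhatLE cs y z) :
    BruhatLE cs x z :=
  Relation.ReflTransGen.trans h h'

theorem BruhatLE.refl (x : W) : BruhatLE cs x x := Relation.ReflTransGen.refl

theorem bruhatLE_simple_mul {w : W} {i : B} (h : cs.length w < cs.length (cs.simple i * w)) :
    BruhatLE cs w (cs.simple i * w) := by
  refine Relation.ReflTransGen.single ⟨w⁻¹ * cs.simple i * w, ?_, by group, h⟩
  simpa using (cs.isReflection_simple i).conj w⁻¹

/-- Left multiplication by a simple reflection preserves an ascent `u < u * t`, unless it exchanges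
the two elements. This is a case of the exchange condition. -/
theorem simple_mul_ascent {u t : W} {i : B} (ht : cs.IsReflection t)
    (h : cs.length u < cs.length (u * t)) (hne : cs.simple i * u ≠ u * t) :
    cs.length (cs.simple i * u) < cs.length (cs.simple i * u * t) := by
  by_contra hlt
  have hlt' := lt_of_le_of_ne (not_lt.mp hlt) (ht.length_mul_left_ne _)
  have h1 := cs.length_simple_mul u i
  have h2 := cs.length_simple_mul (u * t) i
  rw [← mul_assoc] at h2
  obtain ⟨ω, hω, rfl⟩ := cs.exists_isReduced u
  rw [← cs.wordProd_cons] at hlt'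
  obtain ⟨k, hk, he⟩ := exists_eraseIdx_of_length_lt cs (ω := i :: ω) ht hlt'
  rw [cs.wordProd_cons] at he
  cases k with
  | zero =>
    apply hne
    rw [List.eraseIdx_cons_zero] at he
    conv_lhs => rw [← he]
    simp [← mul_assoc]
  | succ k =>
    rw [List.eraseIdx_cons_succ, cs.wordProd_cons, mul_assoc] at he
    rw [mul_left_cancel he] at h
    have h3 := cs.length_wordProd_le (ω.eraseIdx k)
    have h4 : (ω.eraseIdx k).length ≤ ω.length := List.length_eraseIdx_le ω k
    have := hω.eq
    omega

theorem BruhatLE.simple_mul_or {u v : W} (h : BruhatLE cs u v) (i : B) :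
    BruhatLE cs (cs.simple i * u) v ∨ BruhatLE cs (cs.simple i * u) (cs.simple i * v) := by
  induction h with
  | refl => exact Or.inr (BruhatLE.refl cs _)
  | @tail v w _ hstep ih =>
    have hvw : BruhatLE cs v w := Relation.ReflTransGen.single hstep
    obtain ⟨t, ht, rfl, hlt⟩ := hstep
    rcases ih with ih | ih
    · exact Or.inl (ih.trans hvw)
    · by_cases hne : cs.simple i * v = v * t
      · exact Or.inl (hne ▸ ih)
      · refine Or.inr (ih.trans (Relation.ReflTransGen.single ⟨t, ht, by group, ?_⟩))
        rw [← mul_assoc]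
        exact simple_mul_ascent cs ht hlt hne

/-- The lifting property. -/
theorem BruhatLE.simple_mul {u v : W} {i : B} (h : BruhatLE cs u v)
    (hv : cs.length v < cs.length (cs.simple i * v)) :
    BruhatLE cs (cs.simple i * u) (cs.simple i * v) :=
  (h.simple_mul_or cs i).elim (fun h' => h'.trans (bruhatLE_simple_mul cs hv)) id

/-- Induction on the length, by left multiplication with simple reflections. -/
theorem left_induction {p : W → Prop} (one : p 1)
    (simple_mul : ∀ i w, cs.length w < cs.length (cs.simple i * w) → p w → p (cs.simple i * w))
    (w : W) : p w := by
  obtain ⟨ω, hω, rfl⟩ := cs.exists_isReduced w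
  induction ω with
  | nil => simpa using one
  | cons i ω ih =>
    have h' : cs.IsReduced ω := by simpa using hω.drop 1
    have h1 := hω.eq
    have h2 := h'.eq
    rw [cs.wordProd_cons] at h1 ⊢
    rw [List.length_cons] at h1
    exact simple_mul i _ (by omega) (ih h')

/-! ### The inverses of the standard generators -/

namespace Hecke

/-- Right multiplication by `T_s`, when it increases the length. -/
theorem basis_mul_basis_simple {w : W} {i : B} (h : cs.length w < cs.length (w * cs.simple i)) :
    basis cs w * basis cs (cs.simple i) = basis cs (w * cs.simple i) := by
  have h1 : basis cs (cs.simple i) = rightOp cs i (basis cs 1) := by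
    rw [rightOp_basis]; simp
  rw [mul_def, h1, ← Module.End.mul_apply, leftMul_commute cs (basis cs w) i, Module.End.mul_apply,
    leftMul_one, rightOp_basis, if_pos h]

/-- The element `q⁻¹ T_s + (q⁻¹ - 1)`, which is the inverse of `T_s`. -/
noncomputable def simpleInv (i : B) : Hecke cs :=
  (T (-2) : ℤ[T;T⁻¹]) • basis cs (cs.simple i) + (T (-2) - 1 : ℤ[T;T⁻¹]) • 1

theorem T_neg_two_mul_T_two : (T (-2) * T 2 : ℤ[T;T⁻¹]) = 1 := by
  rw [← T_add]; simp

theorem simpleInv_mul_basis (i : B) (w : W) : simpleInv cs i * basis cs w =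
    if cs.length w < cs.length (cs.simple i * w) then
      (T (-2) : ℤ[T;T⁻¹]) • basis cs (cs.simple i * w) + (T (-2) - 1 : ℤ[T;T⁻¹]) • basis cs w
    else basis cs (cs.simple i * w) := by
  rw [simpleInv, add_mul, smul_mul_assoc, smul_mul_assoc, one_mul, basis_simple_mul_basis]
  have h := T_neg_two_mul_T_two
  split_ifs
  · rfl
  · rw [smul_add, smul_smul, smul_smul, mul_sub, h, mul_one, one_smul, ← neg_sub (1 : ℤ[T;T⁻¹])]
    module

theorem basis_simple_mul_simpleInv (i : B) : basis cs (cs.simple i) * simpleInv cs i = 1 := by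
  have h := T_neg_two_mul_T_two
  rw [simpleInv, mul_add, mul_smul_comm, mul_smul_comm, mul_one, basis_simple_mul_basis]
  simp only [cs.simple_mul_simple_self, cs.length_one, cs.length_simple, not_lt_zero, if_false]
  rw [smul_add, smul_smul, smul_smul, mul_sub, h, mul_one, one_smul, ← one_def]
  module

theorem simpleInv_mul_basis_simple (i : B) : simpleInv cs i * basis cs (cs.simple i) = 1 := by
  rw [simpleInv_mul_basis]
  simp [one_def]

theorem isUnit_basis_simple (i : B) : IsUnit (basis cs (cs.simple i)) :=
  ⟨⟨_, _, basis_simple_mul_simpleInv cs i, simpleInv_mul_basis_simple cs i⟩, rfl⟩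

theorem inverse_basis_simple (i : B) : Ring.inverse (basis cs (cs.simple i)) = simpleInv cs i :=
  Ring.inverse_unit
    ⟨_, _, basis_simple_mul_simpleInv cs i, simpleInv_mul_basis_simple cs i⟩

theorem inverse_basis_simple_mul_inv {w : W} {i : B}
    (h : cs.length w < cs.length (cs.simple i * w)) :
    Ring.inverse (basis cs (cs.simple i * w)⁻¹) =
      simpleInv cs i * Ring.inverse (basis cs w⁻¹) := by
  have h' : cs.length w⁻¹ < cs.length (w⁻¹ * cs.simple i) := by
    rw [← cs.length_inv (w⁻¹ * cs.simple i)]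
    simpa using h
  rw [mul_inv_rev, cs.inv_simple, ← basis_mul_basis_simple cs h',
    Ring.inverse_mul (Or.inr (isUnit_basis_simple cs i)), inverse_basis_simple]

/-- The coefficients of `T_s⁻¹ h` in terms of those of `h`. -/
theorem repr_simpleInv_mul (i : B) (h : Hecke cs) (y : W) :
    (basis cs).repr (simpleInv cs i * h) y =
      if cs.length (cs.simple i * y) < cs.length y then
        T (-2) * (basis cs).repr h (cs.simple i * y)
      else (basis cs).repr h (cs.simple i * y) + (T (-2) - 1) * (basis cs).repr h y := by
  classical
  -- Both sides are linear in `h`, so that it suffices to compare them on the standard basis.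
  let c : W → Hecke cs →ₗ[ℤ[T;T⁻¹]] ℤ[T;T⁻¹] := (basis cs).coord
  let F : Hecke cs →ₗ[ℤ[T;T⁻¹]] ℤ[T;T⁻¹] :=
    if cs.length (cs.simple i * y) < cs.length y then
      (T (-2) : ℤ[T;T⁻¹]) • c (cs.simple i * y)
    else c (cs.simple i * y) + (T (-2) - 1 : ℤ[T;T⁻¹]) • c y
  have key : c y ∘ₗ LinearMap.mulLeft ℤ[T;T⁻¹] (simpleInv cs i) = F := by
    refine (basis cs).ext fun w => ?_
    have e1 : cs.simple i * w = y ↔ w = cs.simple i * y := by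
      constructor <;> rintro rfl <;> simp
    have hl := cs.length_simple_mul y i
    rw [LinearMap.comp_apply, LinearMap.mulLeft_apply, simpleInv_mul_basis]
    by_cases hy : cs.length (cs.simple i * y) < cs.length y
    all_goals
      by_cases h1 : w = y
      · have h2 : w ≠ cs.simple i * y := by
          rintro h2
          rw [← h2, h1] at hl; omega
        subst h1
        simp only [F, hy, c, if_true, if_false]
        split_ifs
        · first | omega | simp [h2, e1]
        · first | omega | simp [h2, e1]
      by_cases h2 : w = cs.simple i * y
      · subst h2
        simp only [F, hy, c, if_true, if_false, cs.simple_mul_simple_cancel_left]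
        simp [h1]
      simp only [F, hy, c, if_true, if_false]
      split_ifs <;> simp [h1, h2, e1]
  have := LinearMap.congr_fun key h
  simp only [F, c, LinearMap.comp_apply, LinearMap.mulLeft_apply, Module.Basis.coord_apply] at this
  rw [this]
  split_ifs <;> simp

/-! ### The bar involution -/

/-- The bar involution as a semilinear map. -/
noncomputable def barₛₗ :
    Hecke cs →ₛₗ[((LaurentPolynomial.invert (R := ℤ)) : ℤ[T;T⁻¹] →+* ℤ[T;T⁻¹])] Hecke cs where
  toFun := bar cs
  map_add' a b := by
    classical
    rw [bar, map_add, Finsupp.sum_add_index']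
    · rfl
    · simp
    · simp [add_smul]
  map_smul' r a := by
    rw [bar, map_smul, Finsupp.sum_smul_index (by simp), bar, Finsupp.smul_sum]
    simp [mul_smul]

theorem barₛₗ_apply (h : Hecke cs) : barₛₗ cs h = bar cs h := rfl

theorem bar_basis (w : W) : bar cs (basis cs w) = Ring.inverse (basis cs w⁻¹) := by
  simp [bar]

theorem bar_add (a b : Hecke cs) : bar cs (a + b) = bar cs a + bar cs b := map_add (barₛₗ cs) a b

theorem bar_smul (r : ℤ[T;T⁻¹]) (a : Hecke cs) :
    bar cs (r • a) = LaurentPolynomial.invert r • bar cs a :=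
  map_smulₛₗ (barₛₗ cs) r a

theorem bar_basis_simple_mul {w : W} {i : B} (h : cs.length w < cs.length (cs.simple i * w)) :
    bar cs (basis cs (cs.simple i * w)) = simpleInv cs i * bar cs (basis cs w) := by
  rw [bar_basis, bar_basis, inverse_basis_simple_mul_inv cs h]

theorem bar_simple_mul (i : B) (h : Hecke cs) :
    bar cs (basis cs (cs.simple i) * h) = simpleInv cs i * bar cs h := by
  have key : (barₛₗ cs).comp (LinearMap.mulLeft ℤ[T;T⁻¹] (basis cs (cs.simple i))) =
      (LinearMap.mulLeft ℤ[T;T⁻¹] (simpleInv cs i)).comp (barₛₗ cs) := by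
    refine (basis cs).ext fun w => ?_
    simp only [LinearMap.comp_apply, LinearMap.mulLeft_apply, barₛₗ_apply]
    rw [basis_simple_mul_basis]
    split_ifs with hw
    · exact bar_basis_simple_mul cs hw
    · have hl := cs.length_simple_mul w i
      have h2 := bar_basis_simple_mul cs (w := cs.simple i * w) (i := i)
        (by rw [cs.simple_mul_simple_cancel_left]; omega)
      rw [cs.simple_mul_simple_cancel_left] at h2
      have h3 : simpleInv cs i * simpleInv cs i =
          (T (-2) - 1 : ℤ[T;T⁻¹]) • simpleInv cs i + (T (-2) : ℤ[T;T⁻¹]) • 1 := by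
        nth_rw 1 [simpleInv]
        rw [add_mul, smul_mul_assoc, smul_mul_assoc, one_mul, basis_simple_mul_simpleInv, add_comm]
      rw [bar_add, bar_smul, bar_smul, h2, ← mul_assoc, h3, add_mul, smul_mul_assoc,
        smul_mul_assoc, one_mul]
      simp
  exact LinearMap.congr_fun key h

theorem bar_bar_basis (w : W) : bar cs (bar cs (basis cs w)) = basis cs w := by
  induction w using left_induction cs with
  | one =>
    have h : bar cs (basis cs 1) = basis cs 1 := by
      rw [bar_basis, inv_one, ← one_def, Ring.inverse_one]
    rw [h, h]
  | simple_mul i w hw ih =>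
    have h1 := bar_simple_mul cs i (simpleInv cs i * bar cs (basis cs w))
    rw [← mul_assoc, basis_simple_mul_simpleInv, one_mul, ih] at h1
    rw [bar_basis_simple_mul cs hw]
    have h2 := congrArg (basis cs (cs.simple i) * ·) h1
    simp only [← mul_assoc, basis_simple_mul_simpleInv, one_mul] at h2
    rw [← h2, basis_simple_mul_basis, if_pos hw]

end Hecke

/-! ### Polynomials in `q` inside the Laurent polynomials in `q^{1/2}` -/

/-- The embedding `T ↦ T ^ 2`. It translates between the two roles of the Laurent variable: `q` in
the inversion formulas, `q^{1/2}` in the Hecke algebra. -/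
noncomputable def substSq : ℤ[T;T⁻¹] →+* ℤ[T;T⁻¹] :=
  AddMonoidAlgebra.mapDomainRingHom ℤ (AddMonoidHom.mulLeft (2 : ℤ))

theorem substSq_T (n : ℤ) : substSq (T n) = T (2 * n) := by
  simp only [substSq, T, AddMonoidAlgebra.mapDomainRingHom_apply,
    AddMonoidAlgebra.mapDomain_single]
  rfl

theorem substSq_injective : Function.Injective substSq :=
  AddMonoidAlgebra.mapDomain_injective (f := fun n : ℤ => 2 * n)
    (mul_right_injective₀ two_ne_zero)

theorem substSq_toLaurent (p : ℤ[X]) : substSq (toLaurent p) = aeval (T 2 : ℤ[T;T⁻¹]) p := by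
  have h : substSq.comp toLaurent = (aeval (T 2 : ℤ[T;T⁻¹])).toRingHom := by
    refine Polynomial.ringHom_ext (fun a => ?_) ?_
    · simp
    · simp [substSq_T]
  exact RingHom.congr_fun h p

theorem substSq_invert (f : ℤ[T;T⁻¹]) :
    substSq (LaurentPolynomial.invert f) = LaurentPolynomial.invert (substSq f) := by
  induction f using LaurentPolynomial.induction_on' with
  | add p q hp hq => simp only [map_add, hp, hq]
  | C_mul_T n a => simp [substSq_T]

theorem aeval_T_two_injective : Function.Injective (aeval (T 2 : ℤ[T;T⁻¹]) : ℤ[X] → ℤ[T;T⁻¹]) := by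
  intro p r h
  rw [← substSq_toLaurent, ← substSq_toLaurent] at h
  exact toLaurent_injective (substSq_injective h)

/-! ### The polynomials `R` -/

theorem mul_T_cancel {f g : ℤ[T;T⁻¹]} {n : ℤ} (h : f * T n = g * T n) : f = g :=
  (isUnit_T n).mul_right_cancel h

/-- The equation that `klR` solves. -/
def IsKLR (y x : W) (r : ℤ[X]) : Prop :=
  (Hecke.basis cs).repr (Ring.inverse (Hecke.basis cs x⁻¹)) y =
    LaurentPolynomial.invert (aeval (T 2 : ℤ[T;T⁻¹]) r) * T (-2 * (cs.length y : ℤ))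

variable {cs} in
theorem IsKLR.unique {y x : W} {r r' : ℤ[X]} (h : IsKLR cs y x r) (h' : IsKLR cs y x r') :
    r = r' :=
  aeval_T_two_injective (LaurentPolynomial.invert.injective (mul_T_cancel (h.symm.trans h')))

variable {cs} in
theorem IsKLR.simple_mul_of_gt {y x : W} {i : B} {r : ℤ[X]}
    (hx : cs.length x < cs.length (cs.simple i * x))
    (hy : cs.length (cs.simple i * y) < cs.length y)
    (h : IsKLR cs (cs.simple i * y) x r) : IsKLR cs y (cs.simple i * x) r := by
  have hl := cs.length_simple_mul y i
  rw [IsKLR, Hecke.inverse_basis_simple_mul_inv cs hx, Hecke.repr_simpleInv_mul, if_pos hy, h,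
    ← mul_assoc, mul_comm (T (-2)), mul_assoc, ← T_add]
  congr 2
  omega

variable {cs} in
theorem IsKLR.simple_mul_of_lt {y x : W} {i : B} {r r' : ℤ[X]}
    (hx : cs.length x < cs.length (cs.simple i * x))
    (hy : cs.length y < cs.length (cs.simple i * y))
    (h : IsKLR cs (cs.simple i * y) x r) (h' : IsKLR cs y x r') :
    IsKLR cs y (cs.simple i * x) (X * r + (X - 1) * r') := by
  have hl := cs.length_simple_mul y i
  rw [IsKLR, Hecke.inverse_basis_simple_mul_inv cs hx, Hecke.repr_simpleInv_mul, if_neg (by omega),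
    h, h', show -2 * (cs.length (cs.simple i * y) : ℤ) = -2 + -2 * (cs.length y : ℤ) by omega, T_add]
  simp only [map_add, map_mul, map_sub, map_one, aeval_X, invert_T]
  ring

theorem isKLR_one (y : W) [Decidable (y = 1)] : IsKLR cs y 1 (if y = 1 then 1 else 0) := by
  rw [IsKLR, inv_one, ← Hecke.one_def, Ring.inverse_one, Hecke.one_def]
  split_ifs with h
  · simp [h]
  · simp [Ne.symm h]

/-- The recursion of the coefficients of `(T_{x⁻¹})⁻¹` shows that the polynomials `R` exist. -/
theorem isKLR_klR (y x : W) : IsKLR cs y x (klR cs y x) := by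
  classical
  refine Classical.epsilon_spec (p := IsKLR cs y x) ?_
  induction x using left_induction cs generalizing y with
  | one => exact ⟨_, isKLR_one cs y⟩
  | simple_mul i x hx ih =>
    obtain ⟨r, hr⟩ := ih (cs.simple i * y)
    obtain ⟨r', hr'⟩ := ih y
    rcases lt_or_gt_of_ne (cs.length_simple_mul_ne y i) with hy | hy
    · exact ⟨_, hr.simple_mul_of_gt hx hy⟩
    · exact ⟨_, hr.simple_mul_of_lt hx hy hr'⟩

theorem klR_one_right (y : W) [Decidable (y = 1)] : klR cs y 1 = if y = 1 then 1 else 0 :=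
  (isKLR_klR cs y 1).unique (isKLR_one cs y)

theorem klR_simple_mul_of_gt {y x : W} {i : B} (hx : cs.length x < cs.length (cs.simple i * x))
    (hy : cs.length (cs.simple i * y) < cs.length y) :
    klR cs y (cs.simple i * x) = klR cs (cs.simple i * y) x :=
  (isKLR_klR cs y _).unique ((isKLR_klR cs _ x).simple_mul_of_gt hx hy)

theorem klR_simple_mul_of_lt {y x : W} {i : B} (hx : cs.length x < cs.length (cs.simple i * x))
    (hy : cs.length y < cs.length (cs.simple i * y)) :
    klR cs y (cs.simple i * x) = X * klR cs (cs.simple i * y) x + (X - 1) * klR cs y x :=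
  (isKLR_klR cs y _).unique ((isKLR_klR cs _ x).simple_mul_of_lt hx hy (isKLR_klR cs y x))

theorem klR_self (x : W) : klR cs x x = 1 := by
  classical
  induction x using left_induction cs with
  | one => simp [klR_one_right]
  | simple_mul i x hx ih =>
    rw [klR_simple_mul_of_gt cs hx (by simpa using hx), cs.simple_mul_simple_cancel_left, ih]

theorem klR_eq_zero {y x : W} (h : ¬ BruhatLE cs y x) : klR cs y x = 0 := by
  classical
  induction x using left_induction cs generalizing y with
  | one =>
    rw [klR_one_right, if_neg]
    rintro rfl
    exact h (BruhatLE.refl cs _)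
  | simple_mul i x hx ih =>
    rcases lt_or_gt_of_ne (cs.length_simple_mul_ne y i) with hy | hy
    · rw [klR_simple_mul_of_gt cs hx hy]
      refine ih fun h' => h ?_
      simpa using h'.simple_mul cs hx
    · have hxs := bruhatLE_simple_mul cs hx
      rw [klR_simple_mul_of_lt cs hx hy, ih fun h' => h (h'.trans hxs),
        ih fun h' => h (((bruhatLE_simple_mul cs hy).trans h').trans hxs)]
      simp

/-- The bar conjugate of `R_{y,x}` is `(-1)^{|x| - |y|} q^{|y| - |x|} R_{y,x}`. -/
theorem invert_klR (y x : W) :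
    LaurentPolynomial.invert (toLaurent (klR cs y x)) =
      (-1) ^ (cs.length y + cs.length x) * T ((cs.length y : ℤ) - cs.length x) *
        toLaurent (klR cs y x) := by
  classical
  induction x using left_induction cs generalizing y with
  | one =>
    rw [klR_one_right]
    split_ifs with h
    · simp [h]
    · simp
  | simple_mul i x hx ih =>
    have hlx := cs.length_simple_mul x i
    have hly := cs.length_simple_mul y i
    have ex : cs.length (cs.simple i * x) = cs.length x + 1 := by omega
    rcases lt_or_gt_of_ne (cs.length_simple_mul_ne y i) with hy | hy
    · have ey : cs.length y = cs.length (cs.simple i * y) + 1 := by omega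
      rw [klR_simple_mul_of_gt cs hx hy, ih, ex, ey]
      congr 2
      · ring
      · congr 1; push_cast; ring
    · have ey : cs.length (cs.simple i * y) = cs.length y + 1 := by omega
      have e1 : ((cs.length y + 1 : ℕ) : ℤ) - cs.length x =
        (cs.length y : ℤ) - (cs.length x + 1 : ℕ) + 1 + 1 := by push_cast; ring
      have e2 : (cs.length y : ℤ) - cs.length x =
        (cs.length y : ℤ) - (cs.length x + 1 : ℕ) + 1 := by push_cast; ring
      have e3 : (T (-1) * T 1 : ℤ[T;T⁻¹]) = 1 := by rw [← T_add]; simp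
      rw [klR_simple_mul_of_lt cs hx hy]
      simp only [map_add, map_mul, map_sub, map_one, toLaurent_X, invert_T, ih, ex, ey]
      rw [e1, e2, T_add, T_add]
      set t := (T ((cs.length y : ℤ) - (cs.length x + 1 : ℕ)) : ℤ[T;T⁻¹])
      simp only [pow_add, pow_one]
      linear_combination ((-1) ^ cs.length y * (-1) ^ cs.length x * t) *
        (-T 1 * toLaurent (klR cs (cs.simple i * y) x) + toLaurent (klR cs y x)) * e3

theorem coeff_bar_basis (y x : W) : (Hecke.basis cs).repr (Hecke.bar cs (Hecke.basis cs x)) y =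
    LaurentPolynomial.invert (aeval (T 2 : ℤ[T;T⁻¹]) (klR cs y x)) * T (-2 * (cs.length y : ℤ)) := by
  rw [Hecke.bar_basis]
  exact isKLR_klR cs y x

/-- The coefficients of the bar conjugate of an element supported below `x`. The sum is over the
Bruhat interval because `R_{y,z}` vanishes unless `y ≤ z`. -/
theorem bar_sum_smul_basis (x : W) (a : W → ℤ[T;T⁻¹]) (y : W) :
    (Hecke.basis cs).repr (Hecke.bar cs
        (∑ z ∈ (finite_bruhatLE cs x).toFinset, a z • Hecke.basis cs z)) y =
      ∑ z ∈ bruhatIcc cs y x, LaurentPolynomial.invert (a z) *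
        (LaurentPolynomial.invert (aeval (T 2 : ℤ[T;T⁻¹]) (klR cs y z)) *
          T (-2 * (cs.length y : ℤ))) := by
  rw [← Hecke.barₛₗ_apply, map_sum, map_sum, Finsupp.finsetSum_apply]
  simp only [Hecke.barₛₗ_apply, Hecke.bar_smul, map_smul, Finsupp.smul_apply, coeff_bar_basis,
    smul_eq_mul]
  refine (Finset.sum_subset (fun z hz => ?_) fun z _ hz' => ?_).symm
  · simpa using ((mem_bruhatIcc cs).mp hz).2
  · rw [klR_eq_zero cs, map_zero, map_zero, zero_mul, mul_zero]
    intro h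
    simp_all [mem_bruhatIcc]

theorem bar_basis_eq_sum (x : W) : Hecke.bar cs (Hecke.basis cs x) =
    ∑ z ∈ (finite_bruhatLE cs x).toFinset,
      (LaurentPolynomial.invert (aeval (T 2 : ℤ[T;T⁻¹]) (klR cs z x)) *
        T (-2 * (cs.length z : ℤ))) • Hecke.basis cs z := by
  classical
  refine (Hecke.basis cs).ext_elem fun y => ?_
  rw [coeff_bar_basis, map_sum, Finsupp.finsetSum_apply]
  simp only [map_smul, Finsupp.smul_apply, Module.Basis.repr_self, Finsupp.single_apply,
    smul_eq_mul, mul_ite, mul_one, mul_zero, Finset.sum_ite_eq']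
  split_ifs with h
  · rfl
  · rw [klR_eq_zero cs (by simpa using h)]; simp

/-- The bar conjugate of `R_{y,x}`, with `T ^ 2` for `q`. -/
theorem invert_aeval_klR (y x : W) :
    LaurentPolynomial.invert (aeval (T 2 : ℤ[T;T⁻¹]) (klR cs y x)) =
      (-1) ^ (cs.length y + cs.length x) * T (2 * ((cs.length y : ℤ) - cs.length x)) *
        aeval (T 2 : ℤ[T;T⁻¹]) (klR cs y x) := by
  rw [← substSq_toLaurent, ← substSq_invert, invert_klR]
  simp [substSq_T]

/-- The inversion formula for the `R` polynomials, which says that bar is an involution. -/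
theorem sum_klR_mul_klR (y x : W) [Decidable (y = x)] :
    ∑ z ∈ bruhatIcc cs y x,
      (-1) ^ (cs.length y + cs.length z) * toLaurent (klR cs y z) * toLaurent (klR cs z x) =
      if y = x then 1 else 0 := by
  classical
  apply substSq_injective
  have h := congrArg (fun h => (Hecke.basis cs).repr h y) (Hecke.bar_bar_basis cs x)
  rw [bar_basis_eq_sum] at h
  simp only [bar_sum_smul_basis, Module.Basis.repr_self, Finsupp.single_apply, eq_comm (a := x)] at h
  rw [apply_ite substSq, map_one, map_zero, ← h, map_sum]
  refine Finset.sum_congr rfl fun z _ => ?_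
  simp only [map_mul, map_pow, map_neg, map_one, substSq_toLaurent, invert_T,
    LaurentPolynomial.involutive_invert _]
  have e : (T (-(-2 * (cs.length z : ℤ))) * T (2 * ((cs.length y : ℤ) - cs.length z)) *
      T (-2 * (cs.length y : ℤ)) : ℤ[T;T⁻¹]) = 1 := by
    rw [← T_add, ← T_add, ← T_zero]; congr 1; ring
  rw [invert_aeval_klR cs y z]
  linear_combination -(aeval (T 2 : ℤ[T;T⁻¹]) (klR cs z x) * (-1) ^ (cs.length y + cs.length z) *
    aeval (T 2 : ℤ[T;T⁻¹]) (klR cs y z)) * e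

theorem bruhatIcc_eq_empty {y x : W} (h : ¬ BruhatLE cs y x) : bruhatIcc cs y x = ∅ := by
  refine Finset.eq_empty_of_forall_notMem fun z hz => h ?_
  rw [mem_bruhatIcc] at hz
  exact hz.1.trans hz.2

/-! ### Bar invariance as an identity between polynomials -/

theorem repr_klElement (x : W) (p : W → ℤ[X]) {y : W} (hy : BruhatLE cs y x) :
    (Hecke.basis cs).repr (klElement cs x p) y =
      (-1) ^ (cs.length y + cs.length x) * T (-(cs.length x : ℤ)) *
        substSq (T ((cs.length x : ℤ) - cs.length y) *
          LaurentPolynomial.invert (toLaurent (p y))) := by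
  classical
  rw [klElement, map_sum, Finsupp.finsetSum_apply]
  simp only [map_smul, Finsupp.smul_apply, Module.Basis.repr_self, Finsupp.single_apply,
    smul_eq_mul, mul_ite, mul_one, mul_zero, Finset.sum_ite_eq']
  rw [if_pos (by simpa using hy), map_mul, substSq_T, substSq_invert, substSq_toLaurent]
  have e : (T (cs.length x : ℤ) * T (-2 * (cs.length y : ℤ)) : ℤ[T;T⁻¹]) =
      T (-(cs.length x : ℤ)) * T (2 * ((cs.length x : ℤ) - cs.length y)) := by
    rw [← T_add, ← T_add]; congr 1; ring
  linear_combination ((-1) ^ (cs.length y + cs.length x) *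
    LaurentPolynomial.invert (aeval (T 2 : ℤ[T;T⁻¹]) (p y))) * e

theorem repr_bar_klElement (x : W) (p : W → ℤ[X]) (y : W) :
    (Hecke.basis cs).repr (Hecke.bar cs (klElement cs x p)) y =
      (-1) ^ (cs.length y + cs.length x) * T (-(cs.length x : ℤ)) *
        substSq (∑ z ∈ bruhatIcc cs y x, toLaurent (klR cs y z) * toLaurent (p z)) := by
  rw [klElement, bar_sum_smul_basis, map_sum, Finset.mul_sum]
  refine Finset.sum_congr rfl fun z _ => ?_
  simp only [map_mul, map_pow, map_neg, map_one, substSq_toLaurent, invert_T,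
    LaurentPolynomial.involutive_invert _]
  have e : (T (-(-2 * (cs.length z : ℤ))) * T (2 * ((cs.length y : ℤ) - cs.length z)) *
      T (-2 * (cs.length y : ℤ)) : ℤ[T;T⁻¹]) = 1 := by
    rw [← T_add, ← T_add, ← T_zero]; congr 1; ring
  have e2 : ((-1) ^ cs.length z * (-1) ^ cs.length z : ℤ[T;T⁻¹]) = 1 := by
    rw [← mul_pow]; simp
  rw [invert_aeval_klR cs y z]
  set r := aeval (T 2 : ℤ[T;T⁻¹]) (klR cs y z)
  set s := aeval (T 2 : ℤ[T;T⁻¹]) (p z)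
  simp only [pow_add]
  linear_combination ((-1) ^ cs.length y * (-1) ^ cs.length x * T (-(cs.length x : ℤ)) * r * s) *
    ((-1) ^ cs.length z * (-1) ^ cs.length z * e + e2)

/-- The element `klElement cs x p` is fixed by the bar involution if and only if
`q^{|x| - |y|} p̄_y = ∑ R_{y,z} p_z` for all `y ≤ x`. -/
theorem bar_klElement_eq_iff (x : W) (p : W → ℤ[X]) :
    Hecke.bar cs (klElement cs x p) = klElement cs x p ↔
      ∀ y, BruhatLE cs y x → T ((cs.length x : ℤ) - cs.length y) *
          LaurentPolynomial.invert (toLaurent (p y)) =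
        ∑ z ∈ bruhatIcc cs y x, toLaurent (klR cs y z) * toLaurent (p z) := by
  have hunit (y : W) : IsUnit
      ((-1) ^ (cs.length y + cs.length x) * T (-(cs.length x : ℤ)) : ℤ[T;T⁻¹]) :=
    (isUnit_one.neg.pow _).mul (isUnit_T _)
  constructor
  · intro h y hy
    have h1 := congrArg (fun h => (Hecke.basis cs).repr h y) h
    simp only [repr_bar_klElement, repr_klElement cs x p hy] at h1
    exact (substSq_injective ((hunit y).mul_left_cancel h1)).symm
  · intro h
    refine (Hecke.basis cs).ext_elem fun y => ?_
    rw [repr_bar_klElement]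
    by_cases hy : BruhatLE cs y x
    · rw [repr_klElement cs x p hy, h y hy]
    · classical
      rw [bruhatIcc_eq_empty cs hy, Finset.sum_empty, klElement, map_sum, Finsupp.finsetSum_apply]
      simp only [map_smul, Finsupp.smul_apply, Module.Basis.repr_self, Finsupp.single_apply,
        smul_eq_mul, mul_ite, mul_one, mul_zero, Finset.sum_ite_eq']
      rw [if_neg (by simpa using hy)]
      simp

/-! ### Existence of the Kazhdan-Lusztig polynomials -/

/-- The part of `G` in degrees below `l / 2`. -/
noncomputable def lowerPart (l : ℕ) (G : ℤ[X]) : ℤ[X] :=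
  ∑ d ∈ Finset.range ((l + 1) / 2), monomial d (G.coeff d)

theorem coeff_lowerPart (l : ℕ) (G : ℤ[X]) (n : ℕ) :
    (lowerPart l G).coeff n = if 2 * n < l then G.coeff n else 0 := by
  rw [lowerPart, finsetSum_coeff]
  simp only [coeff_monomial, Finset.sum_ite_eq', Finset.mem_range]
  exact if_congr (by omega) rfl rfl

theorem natDegree_lowerPart {l : ℕ} (hl : 0 < l) (G : ℤ[X]) :
    2 * (lowerPart l G).natDegree + 1 ≤ l := by
  by_contra h
  have h0 : lowerPart l G ≠ 0 := by
    intro h0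
    rw [h0, natDegree_zero] at h
    omega
  refine leadingCoeff_ne_zero.mpr h0 ?_
  rw [leadingCoeff, coeff_lowerPart, if_neg (by omega)]

theorem coeff_toLaurent_natCast (G : ℤ[X]) (n : ℕ) : (toLaurent G).coeff (n : ℤ) = G.coeff n := by
  rw [coeff_toLaurent]
  exact Finsupp.mapDomain_apply Nat.cast_injective _ _

theorem coeff_toLaurent_of_neg (G : ℤ[X]) {n : ℤ} (hn : n < 0) : (toLaurent G).coeff n = 0 := by
  rw [coeff_toLaurent]
  refine Finsupp.mapDomain_of_notMem_range _ _ ?_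
  rintro ⟨m, rfl⟩
  exact absurd hn (not_lt.mpr (Int.natCast_nonneg m))

theorem coeff_toLaurent_lowerPart (l : ℕ) (G : ℤ[X]) (n : ℤ) :
    (toLaurent (lowerPart l G)).coeff n = if 2 * n < l then (toLaurent G).coeff n else 0 := by
  rcases lt_or_ge n 0 with h | h
  · rw [coeff_toLaurent_of_neg _ h, coeff_toLaurent_of_neg _ h, ite_self]
  · lift n to ℕ using h
    rw [coeff_toLaurent_natCast, coeff_toLaurent_natCast, coeff_lowerPart]
    exact if_congr (by omega) rfl rfl

theorem coeff_T_mul (l : ℤ) (f : ℤ[T;T⁻¹]) (n : ℤ) : (T l * f).coeff n = f.coeff (n - l) := by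
  rw [T, AddMonoidAlgebra.coeff_single_mul_apply, one_mul, neg_add_eq_sub]

/-- An antisymmetric polynomial is the difference of a polynomial of low degree and its reflection;
the polynomial of low degree is a truncation. -/
theorem T_mul_invert_neg_lowerPart {l : ℕ} {G : ℤ[X]}
    (hG : T (l : ℤ) * LaurentPolynomial.invert (toLaurent G) = -toLaurent G) :
    T (l : ℤ) * LaurentPolynomial.invert (toLaurent (-lowerPart l G)) =
      toLaurent (-lowerPart l G) + toLaurent G := by
  ext n
  have h := congrArg (fun f => f.coeff n) hG
  simp only [coeff_T_mul, invert_apply, neg_sub, map_neg, mul_neg, AddMonoidAlgebra.coeff_neg,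
    AddMonoidAlgebra.coeff_add, Finsupp.neg_apply, Finsupp.add_apply,
    coeff_toLaurent_lowerPart] at h ⊢
  rcases lt_trichotomy (2 * n) l with h1 | h1 | h1
  · rw [if_neg (by omega), if_pos h1]; ring
  · rw [if_neg (by omega), if_neg (by omega)]
    rw [show (l : ℤ) - n = n by omega] at h
    omega
  · rw [if_pos (by omega), if_neg (by omega), h]; ring

open Classical in
/-- The solution of the equations of `bar_klElement_eq_iff`, by descending recursion on `y`: the sum
of the terms `z ≠ y` is antisymmetric, and the term for `y` is minus its lower half. -/
noncomputable def klSolution (x y : W) : ℤ[X] :=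
  if y = x then 1
  else -lowerPart (cs.length x - cs.length y)
    (∑ z : {z // z ∈ (bruhatIcc cs y x).erase y}, klR cs y z.1 * klSolution x z.1)
termination_by cs.length x - cs.length y
decreasing_by
  have hz := z.2
  rw [Finset.mem_erase, mem_bruhatIcc] at hz
  obtain ⟨hne, h1, h2⟩ := hz
  have h3 := (h1.eq_or_length_lt cs).resolve_left (Ne.symm hne)
  rcases h2.eq_or_length_lt cs with h4 | h4
  · rw [h4] at h3 ⊢; omega
  · omega

theorem klSolution_self (x : W) : klSolution cs x x = 1 := by
  rw [klSolution, if_pos rfl]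

open Classical in
theorem klSolution_of_ne {x y : W} (h : y ≠ x) : klSolution cs x y =
    -lowerPart (cs.length x - cs.length y)
      (∑ z ∈ (bruhatIcc cs y x).erase y, klR cs y z * klSolution cs x z) := by
  rw [klSolution, if_neg h]
  congr 2
  exact Finset.sum_coe_sort ((bruhatIcc cs y x).erase y) (fun z => klR cs y z * klSolution cs x z)

theorem bruhatIcc_self (x : W) : bruhatIcc cs x x = {x} := by
  ext z
  rw [mem_bruhatIcc, Finset.mem_singleton]
  constructor
  · rintro ⟨h1, h2⟩
    rcases h1.eq_or_length_lt cs with h | h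
    · exact h.symm
    · rcases h2.eq_or_length_lt cs with h' | h'
      · exact h'
      · omega
  · rintro rfl
    exact ⟨BruhatLE.refl cs _, BruhatLE.refl cs _⟩

theorem left_mem_bruhatIcc {y x : W} (h : BruhatLE cs y x) : y ∈ bruhatIcc cs y x :=
  (mem_bruhatIcc cs).mpr ⟨BruhatLE.refl cs y, h⟩

theorem T_mul_invert_klSolution (x : W) {y : W} (hy : BruhatLE cs y x) :
    T ((cs.length x : ℤ) - cs.length y) *
        LaurentPolynomial.invert (toLaurent (klSolution cs x y)) =
      ∑ z ∈ bruhatIcc cs y x, toLaurent (klR cs y z) * toLaurent (klSolution cs x z) := by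
  classical
  induction hn : cs.length x - cs.length y using Nat.strong_induction_on generalizing y with
  | _ n ih =>
    by_cases hne : y = x
    · subst hne
      simp [bruhatIcc_self, klSolution_self, klR_self]
    have hlt := (hy.eq_or_length_lt cs).resolve_left hne
    have hcast : (cs.length x : ℤ) - cs.length y = n := by omega
    -- For `z > y` the equation holds by induction; it is used to conjugate the sum over these `z`.
    have ih' : ∀ z ∈ (bruhatIcc cs y x).erase y, T ((cs.length x : ℤ) - cs.length z) *
          LaurentPolynomial.invert (toLaurent (klSolution cs x z)) =
        ∑ w ∈ bruhatIcc cs z x, toLaurent (klR cs z w) * toLaurent (klSolution cs x w) := by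
      intro z hz
      rw [Finset.mem_erase, mem_bruhatIcc] at hz
      obtain ⟨hz0, hz1, hz2⟩ := hz
      have := (hz1.eq_or_length_lt cs).resolve_left (Ne.symm hz0)
      exact ih _ (by omega) hz2 rfl
    set G : ℤ[X] := ∑ z ∈ (bruhatIcc cs y x).erase y, klR cs y z * klSolution cs x z with hGdef
    have hP : klSolution cs x y = -lowerPart n G := by
      rw [klSolution_of_ne cs hne, hn]
    have hG : T (n : ℤ) * LaurentPolynomial.invert (toLaurent G) = -toLaurent G := by
      -- The double sum over `y < z ≤ w ≤ x`; the inversion formula for `R` evaluates the sum over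
      -- `z`, in which only the term `z = y` is missing.
      have step1 : T (n : ℤ) * LaurentPolynomial.invert (toLaurent G) =
          ∑ z ∈ (bruhatIcc cs y x).erase y, ∑ w ∈ (bruhatIcc cs y x).erase y,
            (-1) ^ (cs.length y + cs.length z) * toLaurent (klR cs y z) *
              toLaurent (klR cs z w) * toLaurent (klSolution cs x w) := by
        rw [hGdef, map_sum, map_sum, Finset.mul_sum]
        refine Finset.sum_congr rfl fun z hz => ?_
        have hz' := hz
        rw [Finset.mem_erase, mem_bruhatIcc] at hz'
        obtain ⟨hz0, hz1, hz2⟩ := hz'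
        have h1 : ∑ w ∈ (bruhatIcc cs y x).erase y,
            toLaurent (klR cs z w) * toLaurent (klSolution cs x w) =
            ∑ w ∈ bruhatIcc cs z x, toLaurent (klR cs z w) * toLaurent (klSolution cs x w) := by
          refine (Finset.sum_subset (fun w hw => ?_) fun w hw hw' => ?_).symm
          · rw [mem_bruhatIcc] at hw
            rw [Finset.mem_erase, mem_bruhatIcc]
            refine ⟨?_, hz1.trans hw.1, hw.2⟩
            rintro rfl
            have h2 := (hz1.eq_or_length_lt cs).resolve_left (Ne.symm hz0)
            have h3 := (hw.1.eq_or_length_lt cs).resolve_left hz0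
            omega
          · rw [Finset.mem_erase, mem_bruhatIcc] at hw
            rw [klR_eq_zero cs, map_zero, zero_mul]
            exact fun h => hw' ((mem_bruhatIcc cs).mpr ⟨h, hw.2.2⟩)
        have h2 : ∑ w ∈ (bruhatIcc cs y x).erase y,
            (-1) ^ (cs.length y + cs.length z) * toLaurent (klR cs y z) *
              toLaurent (klR cs z w) * toLaurent (klSolution cs x w) =
            (-1) ^ (cs.length y + cs.length z) * toLaurent (klR cs y z) *
              (T ((cs.length x : ℤ) - cs.length z) *
                LaurentPolynomial.invert (toLaurent (klSolution cs x z))) := by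
          rw [ih' z hz, ← h1, Finset.mul_sum]
          exact Finset.sum_congr rfl fun w _ => by ring
        have e : (T (n : ℤ) * T ((cs.length y : ℤ) - cs.length z) : ℤ[T;T⁻¹]) =
            T ((cs.length x : ℤ) - cs.length z) := by
          rw [← T_add]; congr 1; omega
        rw [h2, map_mul, map_mul, invert_klR, ← e]
        ring
      rw [step1, Finset.sum_comm, hGdef, map_sum, ← Finset.sum_neg_distrib]
      refine Finset.sum_congr rfl fun w hw => ?_
      have hw' := hw
      rw [Finset.mem_erase, mem_bruhatIcc] at hw'
      obtain ⟨hw0, hw1, hw2⟩ := hw'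
      have h1 : ∑ z ∈ (bruhatIcc cs y x).erase y, (-1) ^ (cs.length y + cs.length z) *
            toLaurent (klR cs y z) * toLaurent (klR cs z w) =
          ∑ z ∈ (bruhatIcc cs y w).erase y, (-1) ^ (cs.length y + cs.length z) *
            toLaurent (klR cs y z) * toLaurent (klR cs z w) := by
        refine (Finset.sum_subset (Finset.erase_subset_erase _ fun z hz => ?_)
          fun z hz hz' => ?_).symm
        · rw [mem_bruhatIcc] at hz ⊢
          exact ⟨hz.1, hz.2.trans hw2⟩
        · rw [Finset.mem_erase, mem_bruhatIcc] at hz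
          rw [klR_eq_zero cs (y := z), map_zero, mul_zero]
          exact fun h => hz' (Finset.mem_erase.mpr ⟨hz.1, (mem_bruhatIcc cs).mpr ⟨hz.2.1, h⟩⟩)
      have h2 := sum_klR_mul_klR cs y w
      rw [if_neg (Ne.symm hw0), ← Finset.add_sum_erase _ _ (left_mem_bruhatIcc cs hw1), klR_self,
        ← h1, map_one, mul_one, ← two_mul, pow_mul, neg_one_sq, one_pow, one_mul] at h2
      rw [← Finset.sum_mul, map_mul]
      linear_combination toLaurent (klSolution cs x w) * h2
    rw [← Finset.add_sum_erase _ _ (left_mem_bruhatIcc cs hy), klR_self, map_one, one_mul, hcast,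
      hP, T_mul_invert_neg_lowerPart hG, hGdef, map_sum]
    simp only [map_mul]

open Classical in
theorem isKLFamily_klSolution (x : W) :
    IsKLFamily cs x fun y => if BruhatLE cs y x then klSolution cs x y else 0 where
  eq_zero y hy := if_neg hy
  eq_one := by rw [if_pos (BruhatLE.refl cs x), klSolution_self]
  degree_le y hy hne := by
    have hlt := (hy.eq_or_length_lt cs).resolve_left hne
    rw [if_pos hy, klSolution_of_ne cs hne, natDegree_neg]
    have := natDegree_lowerPart (l := cs.length x - cs.length y) (by omega)
      (∑ z ∈ (bruhatIcc cs y x).erase y, klR cs y z * klSolution cs x z)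
    omega
  bar_eq := by
    rw [bar_klElement_eq_iff]
    intro y hy
    rw [if_pos hy, T_mul_invert_klSolution cs x hy]
    exact Finset.sum_congr rfl fun z hz => by rw [if_pos ((mem_bruhatIcc cs).mp hz).2]

theorem isKLFamily_klP (x : W) : IsKLFamily cs x fun y => klP cs y x :=
  Classical.epsilon_spec (p := IsKLFamily cs x) ⟨_, isKLFamily_klSolution cs x⟩

theorem klP_self (x : W) : klP cs x x = 1 := (isKLFamily_klP cs x).eq_one

theorem klP_eq_zero {y x : W} (h : ¬ BruhatLE cs y x) : klP cs y x = 0 :=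
  (isKLFamily_klP cs x).eq_zero y h

theorem sum_klR_mul_klP {y x : W} (h : BruhatLE cs y x) :
    ∑ z ∈ bruhatIcc cs y x, toLaurent (klR cs y z) * toLaurent (klP cs z x) =
      T ((cs.length x : ℤ) - cs.length y) * LaurentPolynomial.invert (toLaurent (klP cs y x)) :=
  ((bar_klElement_eq_iff cs x _).mp (isKLFamily_klP cs x).bar_eq y h).symm

/-! ### The inverse Kazhdan-Lusztig polynomials -/

theorem klQ_self (x : W) : klQ cs x x = 1 := by
  rw [klQ, if_pos rfl]

open Classical in
theorem klQ_of_ne {y x : W} (h : y ≠ x) : klQ cs y x =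
    -∑ z ∈ (bruhatIcc cs y x).erase y,
      (-1) ^ (cs.length y + cs.length z) * klP cs y z * klQ cs z x := by
  rw [klQ, if_neg h]
  congr 1
  exact Finset.sum_coe_sort ((bruhatIcc cs y x).erase y)
    (fun z => (-1) ^ (cs.length y + cs.length z) * klP cs y z * klQ cs z x)

theorem klQ_eq_zero {y x : W} (h : ¬ BruhatLE cs y x) : klQ cs y x = 0 := by
  have hne : y ≠ x := by
    rintro rfl
    exact h (BruhatLE.refl cs _)
  rw [klQ_of_ne cs hne, bruhatIcc_eq_empty cs h]
  simp

theorem sum_klP_mul_klQ (y x : W) [Decidable (y = x)] :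
    ∑ z ∈ bruhatIcc cs y x, (-1) ^ (cs.length y + cs.length z) * klP cs y z * klQ cs z x =
      if y = x then 1 else 0 := by
  classical
  split_ifs with h
  · subst h
    simp [bruhatIcc_self, klP_self, klQ_self, ← two_mul]
  · by_cases hle : BruhatLE cs y x
    · rw [← Finset.add_sum_erase _ _ (left_mem_bruhatIcc cs hle), klQ_of_ne cs h, klP_self,
        ← two_mul, pow_mul, neg_one_sq, one_pow, one_mul, one_mul, neg_add_cancel]
    · simp [bruhatIcc_eq_empty cs hle]

/-- The matrix of a function of two variables on a Bruhat interval. -/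
def intervalMatrix {A : Type*} (y x : W) (f : W → W → A) :
    Matrix (bruhatIcc cs y x) (bruhatIcc cs y x) A :=
  Matrix.of fun a b => f a b

theorem intervalMatrix_apply {A : Type*} (y x : W) (f : W → W → A) (a b : bruhatIcc cs y x) :
    intervalMatrix cs y x f a b = f a b := rfl

theorem intervalMatrix_mul_apply {A : Type*} [CommRing A] {y x : W} {f g : W → W → A}
    (hf : ∀ a b, ¬ BruhatLE cs a b → f a b = 0) (hg : ∀ a b, ¬ BruhatLE cs a b → g a b = 0)
    (a b : bruhatIcc cs y x) :
    (intervalMatrix cs y x f * intervalMatrix cs y x g) a b =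
      ∑ z ∈ bruhatIcc cs a b, f a z * g z b := by
  rw [Matrix.mul_apply]
  simp only [intervalMatrix_apply]
  rw [Finset.sum_coe_sort (bruhatIcc cs y x) (fun z => f a z * g z b)]
  have ha := (mem_bruhatIcc cs).mp a.2
  have hb := (mem_bruhatIcc cs).mp b.2
  refine (Finset.sum_subset (fun z hz => ?_) fun z _ hz => ?_).symm
  · rw [mem_bruhatIcc] at hz ⊢
    exact ⟨ha.1.trans hz.1, hz.2.trans hb.2⟩
  · by_cases h : BruhatLE cs a z
    · rw [hg, mul_zero]
      exact fun h' => hz ((mem_bruhatIcc cs).mpr ⟨h, h'⟩)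
    · rw [hf _ _ h, zero_mul]

/-- Since bar is an involution, `R` is inverted by a change of signs, and so is `P` by the definition
of `Q`. Thus this is the equation `sum_klR_mul_klP` for the inverse matrices. -/
theorem sum_klQ_mul_klR {y x : W} (hyx : BruhatLE cs y x) :
    ∑ z ∈ bruhatIcc cs y x, toLaurent (klQ cs y z) * toLaurent (klR cs z x) =
      T ((cs.length x : ℤ) - cs.length y) * LaurentPolynomial.invert (toLaurent (klQ cs y x)) := by
  classical
  let ε (a b : W) : ℤ[T;T⁻¹] := (-1) ^ (cs.length a + cs.length b)
  let t (a b : W) : ℤ[T;T⁻¹] := T ((cs.length b : ℤ) - cs.length a)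
  have hε (a b c : W) : ε a b * ε b c = ε a c := by
    simp only [ε]
    rw [← pow_add, show cs.length a + cs.length b + (cs.length b + cs.length c) =
      cs.length a + cs.length c + 2 * cs.length b by ring, pow_add, pow_mul, neg_one_sq, one_pow,
      mul_one]
  have ht (a b c : W) : t a b * t b c = t a c := by
    simp only [t]
    rw [← T_add]; congr 1; ring
  have ht0 (a : W) : t a a = 1 := by simp [t]
  have hbar (a b : W) : LaurentPolynomial.invert (ε a b) = ε a b := by simp [ε]
  let P (a b : W) : ℤ[T;T⁻¹] := ε a b * toLaurent (klP cs a b)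
  let Q (a b : W) : ℤ[T;T⁻¹] := toLaurent (klQ cs a b)
  let R (a b : W) : ℤ[T;T⁻¹] := toLaurent (klR cs a b)
  let R' (a b : W) : ℤ[T;T⁻¹] := ε a b * R a b
  let Pbar (a b : W) : ℤ[T;T⁻¹] := t a b * LaurentPolynomial.invert (P a b)
  let Qbar (a b : W) : ℤ[T;T⁻¹] := t a b * LaurentPolynomial.invert (Q a b)
  have hP (a b : W) (h : ¬ BruhatLE cs a b) : P a b = 0 := by simp [P, klP_eq_zero cs h]
  have hQ (a b : W) (h : ¬ BruhatLE cs a b) : Q a b = 0 := by simp [Q, klQ_eq_zero cs h]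
  have hR (a b : W) (h : ¬ BruhatLE cs a b) : R a b = 0 := by simp [R, klR_eq_zero cs h]
  have hR' (a b : W) (h : ¬ BruhatLE cs a b) : R' a b = 0 := by simp [R', hR _ _ h]
  have hPbar (a b : W) (h : ¬ BruhatLE cs a b) : Pbar a b = 0 := by simp [Pbar, hP _ _ h]
  have hQbar (a b : W) (h : ¬ BruhatLE cs a b) : Qbar a b = 0 := by simp [Qbar, hQ _ _ h]
  -- With `m` for the matrices on the interval, the known equations are `P Q = 1`, `R' R = 1` and
  -- `R' P = P̄`; the conclusion is `Q R = Q̄`.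
  let m := intervalMatrix (A := ℤ[T;T⁻¹]) cs y x
  have hsum (a b : W) : ∑ z ∈ bruhatIcc cs a b, P a z * Q z b = if a = b then 1 else 0 := by
    have h := congrArg toLaurent (sum_klP_mul_klQ cs a b)
    rw [apply_ite toLaurent, map_one, map_zero, map_sum] at h
    rw [← h]
    exact Finset.sum_congr rfl fun z _ => by simp [P, Q, ε]
  have hPQ : m P * m Q = 1 := by
    ext1 a b
    rw [intervalMatrix_mul_apply cs hP hQ, hsum, Matrix.one_apply]
    simp only [Subtype.ext_iff]
  have hPQbar : m Pbar * m Qbar = 1 := by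
    ext1 a b
    have h := congrArg (fun f => t a b * LaurentPolynomial.invert f) (hsum a b)
    simp only [map_sum, map_mul, Finset.mul_sum] at h
    rw [intervalMatrix_mul_apply cs hPbar hQbar, Matrix.one_apply]
    simp only [Subtype.ext_iff]
    refine Eq.trans (Finset.sum_congr rfl fun z _ => ?_) (h.trans ?_)
    · rw [← ht a z b]
      simp only [Pbar, Qbar]
      ring
    · split_ifs with hab
      · rw [hab, ht0, map_one, mul_one]
      · rw [map_zero, mul_zero]
  have hRR : m R' * m R = 1 := by
    ext1 a b
    rw [intervalMatrix_mul_apply cs hR' hR, Matrix.one_apply]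
    simp only [Subtype.ext_iff]
    exact sum_klR_mul_klR cs a b
  have hRP : m R' * m P = m Pbar := by
    ext1 a b
    rw [intervalMatrix_mul_apply cs hR' hP]
    change _ = Pbar a b
    by_cases hab : BruhatLE cs a b
    · simp only [Pbar, P, map_mul, hbar]
      rw [mul_left_comm, ← sum_klR_mul_klP cs hab, Finset.mul_sum]
      refine Finset.sum_congr rfl fun z _ => ?_
      rw [← hε a z b]
      simp only [R', R]
      ring
    · rw [hPbar _ _ hab, bruhatIcc_eq_empty cs hab, Finset.sum_empty]
  have hQR : m Q * m R = m Qbar := by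
    have h1 : m R * m Pbar = m P := by
      rw [← hRP, ← mul_assoc, mul_eq_one_comm.mp hRR, one_mul]
    calc m Q * m R = m Q * (m R * m Pbar) * m Qbar := by
          rw [mul_assoc, mul_assoc, hPQbar, mul_one]
      _ = m Qbar := by rw [h1, mul_eq_one_comm.mp hPQ, one_mul]
  have h := congrFun (congrFun hQR ⟨y, left_mem_bruhatIcc cs hyx⟩)
    ⟨x, (mem_bruhatIcc cs).mpr ⟨hyx, BruhatLE.refl cs x⟩⟩
  rwa [intervalMatrix_mul_apply cs hQ hR] at h

/-! ### The symmetry of `Ξ` -/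

theorem toLaurent_klXi_eq_sum_invert_klP (y x : W) :
    toLaurent (klXi cs y x) = T (cs.length x : ℤ) * ∑ y' ∈ bruhatIcc cs y x,
      T (-(cs.length y' : ℤ)) * toLaurent (klQ cs y y') *
        LaurentPolynomial.invert (toLaurent (klP cs y' x)) := by
  have hcomm : klXi cs y x = ∑ y' ∈ bruhatIcc cs y x, ∑ x' ∈ bruhatIcc cs y' x,
      klQ cs y y' * klR cs y' x' * klP cs x' x := by
    refine Finset.sum_comm' fun x' y' => ?_
    simp only [mem_bruhatIcc]
    constructor
    · rintro ⟨⟨_, h2⟩, h3, h4⟩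
      exact ⟨⟨h4, h2⟩, h3, h4.trans h2⟩
    · rintro ⟨⟨h1, h2⟩, h3, _⟩
      exact ⟨⟨h3.trans h1, h2⟩, h3, h1⟩
  rw [hcomm, map_sum, Finset.mul_sum]
  refine Finset.sum_congr rfl fun y' hy' => ?_
  have h := sum_klR_mul_klP cs ((mem_bruhatIcc cs).mp hy').2
  rw [sub_eq_add_neg, T_add] at h
  simp only [map_sum, map_mul, mul_assoc]
  rw [← Finset.mul_sum, h]
  ring

theorem toLaurent_klXi_eq_sum_invert_klQ (y x : W) :
    toLaurent (klXi cs y x) = T (-(cs.length y : ℤ)) * ∑ x' ∈ bruhatIcc cs y x,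
      T (cs.length x' : ℤ) * LaurentPolynomial.invert (toLaurent (klQ cs y x')) *
        toLaurent (klP cs x' x) := by
  rw [klXi, map_sum, Finset.mul_sum]
  refine Finset.sum_congr rfl fun x' hx' => ?_
  have h := sum_klQ_mul_klR cs ((mem_bruhatIcc cs).mp hx').1
  rw [sub_eq_add_neg, T_add] at h
  simp only [map_sum, map_mul]
  rw [← Finset.sum_mul, h]
  ring

end KazhdanLusztig

theorem mainTheorem3 {B W : Type*} [Group W] {M : CoxeterMatrix B} (cs : CoxeterSystem M W)
    (y x : W) (hyx : KazhdanLusztig.BruhatLE cs y x) :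
    (Polynomial.toLaurent (KazhdanLusztig.klXi cs y x) =
      LaurentPolynomial.T (cs.length x : ℤ) *
        ∑ y' ∈ KazhdanLusztig.bruhatIcc cs y x,
          LaurentPolynomial.T (-(cs.length y' : ℤ)) *
            Polynomial.toLaurent (KazhdanLusztig.klQ cs y y') *
            LaurentPolynomial.invert (Polynomial.toLaurent (KazhdanLusztig.klP cs y' x))) ∧
    (Polynomial.toLaurent (KazhdanLusztig.klXi cs y x) =
      LaurentPolynomial.T (-(cs.length y : ℤ)) *
        ∑ x' ∈ KazhdanLusztig.bruhatIcc cs y x,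
          LaurentPolynomial.T (cs.length x' : ℤ) *
            LaurentPolynomial.invert (Polynomial.toLaurent (KazhdanLusztig.klQ cs y x')) *
            Polynomial.toLaurent (KazhdanLusztig.klP cs x' x)) ∧
    LaurentPolynomial.invert (Polynomial.toLaurent (KazhdanLusztig.klXi cs y x)) =
      LaurentPolynomial.T ((cs.length y : ℤ) - (cs.length x : ℤ)) *
        Polynomial.toLaurent (KazhdanLusztig.klXi cs y x) := by
  have hb := KazhdanLusztig.toLaurent_klXi_eq_sum_invert_klP cs y x
  have hc := KazhdanLusztig.toLaurent_klXi_eq_sum_invert_klQ cs y x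
  refine ⟨hb, hc, ?_⟩
  -- The bar conjugate of the first sum is the second one.
  have e : (LaurentPolynomial.T ((cs.length y : ℤ) - cs.length x) *
      LaurentPolynomial.T (-(cs.length y : ℤ)) : LaurentPolynomial ℤ) =
      LaurentPolynomial.T (-(cs.length x : ℤ)) := by
    rw [← LaurentPolynomial.T_add]; congr 1; ring
  rw [hc, ← mul_assoc, e, ← hc, hb, map_mul, map_sum, LaurentPolynomial.invert_T]
  simp only [map_mul, LaurentPolynomial.invert_T, neg_neg,
    LaurentPolynomial.involutive_invert _]
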